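/- **Conventions.** Let $k$ be a field. For $\mathbf d\in\mathbb Z^n$ put $\deg(\mathbf d)=d_1+\cdots+d_n$. A function $f\colon\mathbb Z^n\to\mathbb Z$ is a *Riemann function* if for some $C,a,b\in\mathbb Z$ we have $f(\mathbf d)=0$ whenever $\deg(\mathbf d)\le a$ and $f(\mathbf d)=\deg(\mathbf d)+C$ whenever $\deg(\mathbf d)\ge b$. For distinct $i,j\in[n]$ and $\mathbf d\in\mathbb Z^n$ let $f_{i,j,\mathbf d}(a_i,a_j)=f(\mathbf d+a_i\mathbf e_i+a_j\mathbf e_j)$, and let $W_{f;i,j,\mathbf d}\colon\mathbb Z^2\to\mathbb Z$ be its *weight*, i.e. the unique function $W$ that vanishes in all sufficiently small degrees and satisfies $f_{i,j,\mathbf d}(\mathbf a)=\sum_{\mathbf a'\le\mathbf a}W(\mathbf a')$ for all $\mathbf a\in\mathbb Z^2$. A *$k$-diagram* $\mathcal F$ consists of $k$-vector spaces $\mathcal F(B_1),\mathcal F(B_2),\mathcal F(B_3),\mathcal F(A_1),\mathcal F(A_2)$ and linear maps $\rho_{ij}\colon\mathcal F(B_i)\to\mathcal F(A_j)$ for $(i,j)\in\{(1,1),(2,2),(3,1),(3,2)\}$.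 Isomorphisms and direct sums are taken value by value. $\mathcal F$ is *Fredholm* if the map $(b_1,b_2,b_3)\mapsto(\rho_{11}b_1-\rho_{31}b_3,\ \rho_{22}b_2-\rho_{32}b_3)$ has finite-dimensional kernel and cokernel. A *virtual $k$-diagram* is a pair $\mathcal F_1\ominus\mathcal F_2$ of Fredholm $k$-diagrams; $\mathcal F_1\ominus\mathcal F_2$ and $\mathcal F_1'\ominus\mathcal F_2'$ are *equivalent* if $\mathcal F_1\oplus\mathcal F_2'\oplus\mathcal F_0\simeq\mathcal F_1'\oplus\mathcal F_2\oplus\mathcal F_0$ for some Fredholm $k$-diagram $\mathcal F_0$. A *perfect matching* is a function $W\colon\mathbb Z^2\to\mathbb Z$, vanishing in all sufficiently small and all sufficiently large degrees, such that for some bijection $\pi\colon\mathbb Z\to\mathbb Z$ we have $W(a_1,a_2)=1$ if $a_2=\pi(a_1)$ and $W(a_1,a_2)=0$ otherwise. For such $W$ and $\mathbf d\in\mathbb Z^2$, $\mathcal M_{W,\mathbf d}$ is the $k$-diagram with $\mathcal M_{W,\mathbf d}(B_i)=k^{\oplus\mathbb Z_{\le d_i}}$ and $\mathcal M_{W,\mathbf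 d}(A_i)=k^{\oplus\mathbb Z}$ for $i=1,2$, with $\mathcal M_{W,\mathbf d}(B_3)=k^{\oplus\{\mathbf a\,:\,W(\mathbf a)=1\}}$, with $\rho_{11},\rho_{22}$ the inclusions, and with $\rho_{3j}(\mathbf e_{(a_1,a_2)})=\mathbf e_{a_j}$. If $W\colon\mathbb Z^2\to\mathbb Z$ can be written as $$W=(W_1+\cdots+W_s)-(\tilde W_1+\cdots+\tilde W_{s-1})\qquad(*)$$ with $s\ge1$ and perfect matchings $W_r,\tilde W_r$, then $[\mathcal M_{W,\mathbf d}]$ denotes the equivalence class of the virtual $k$-diagram $\bigl(\bigoplus_{r=1}^s\mathcal M_{W_r,\mathbf d}\bigr)\ominus\bigl(\bigoplus_{r=1}^{s-1}\mathcal M_{\tilde W_r,\mathbf d}\bigr)$. Put $[\mathcal M_{f;i,j,\mathbf d}]=[\mathcal M_{W_{f;i,j,\mathbf d},\mathbf 0}]$. **Theorem.** Let $f\colon\mathbb Z^n\to\mathbb Z$ be a Riemann function and $\mathbf d\in\mathbb Z^n$. 1. For distinct $i,j\in[n]$, the weight $W_{f;i,j,\mathbf d}$ can be written as in $(*)$ if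 and only if it is bounded; in that case the direct sums in the definition of $[\mathcal M_{f;i,j,\mathbf d}]$ are Fredholm, and the class $[\mathcal M_{f;i,j,\mathbf d}]$ does not depend on the choice of $(*)$. 2. If $n\ge3$ and $i,j,j'\in[n]$ are distinct, and $W_{f;i,j,\mathbf d}$ and $W_{f;i,j',\mathbf d}$ are bounded, then $[\mathcal M_{f;i,j,\mathbf d}]=[\mathcal M_{f;i,j',\mathbf d}]$. 3. If $n\ge2$, the class $[\mathcal M_{f;i,j,\mathbf d}]$ is independent of the choice of distinct $i,j\in[n]$: for $i\ne j$ and $i'\ne j'$ in $[n]$ such that $W_{f;i,j,\mathbf d}$ and $W_{f;i',j',\mathbf d}$ are bounded, $[\mathcal M_{f;i,j,\mathbf d}]=[\mathcal M_{f;i',j',\mathbf d}]$. -/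

import Mathlib

universe u

/-! ### Riemann functions and weights -/

/-- The degree of an integer vector. -/
def vecDeg {n : ℕ} (d : Fin n → ℤ) : ℤ := ∑ i, d i

/-- `f : ℤⁿ → ℤ` is a Riemann function: it vanishes in small degree and equals `deg + C` in
large degree. -/
def IsRiemann {n : ℕ} (f : (Fin n → ℤ) → ℤ) : Prop :=
  ∃ C a b : ℤ, (∀ d, vecDeg d ≤ a → f d = 0) ∧ (∀ d, b ≤ vecDeg d → f d = vecDeg d + C)

/-- The two-variable restriction `f_{i,j,d}(a_i, a_j) = f(d + a_i e_i + a_j e_j)`. -/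
def twoVar {n : ℕ} (f : (Fin n → ℤ) → ℤ) (i j : Fin n) (d : Fin n → ℤ) : ℤ × ℤ → ℤ :=
  fun p => f (d + Pi.single i p.1 + Pi.single j p.2)

/-- `W : ℤ² → ℤ` vanishes in sufficiently small degree. -/
def InitiallyZero (W : ℤ × ℤ → ℤ) : Prop := ∃ a : ℤ, ∀ p, p.1 + p.2 ≤ a → W p = 0

/-- `W : ℤ² → ℤ` vanishes in sufficiently large degree. -/
def EventuallyZero (W : ℤ × ℤ → ℤ) : Prop := ∃ b : ℤ, ∀ p, b ≤ p.1 + p.2 → W p = 0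

/-- The weight of an (initially zero) function `g : ℤ² → ℤ`, given by Möbius inversion. By
`isWeight_iff` below it is the unique initially zero `W` with `g d = ∑_{d' ≤ d} W d'`. -/
def weight (g : ℤ × ℤ → ℤ) : ℤ × ℤ → ℤ :=
  fun p => g p - g (p.1 - 1, p.2) - g (p.1, p.2 - 1) + g (p.1 - 1, p.2 - 1)

/-- `W` is initially zero and `g d = ∑_{d' ≤ d} W d'` (a sum with finitely many nonzero terms). -/
def IsWeight (g W : ℤ × ℤ → ℤ) : Prop :=
  InitiallyZero W ∧ ∀ d, g d = ∑ᶠ d' ∈ Set.Iic d, W d'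

theorem finite_Iic_inter_support {W : ℤ × ℤ → ℤ} (hW : InitiallyZero W) (d : ℤ × ℤ) :
    (Set.Iic d ∩ Function.support W).Finite := by
  obtain ⟨a, ha⟩ := hW
  refine (Set.finite_Icc ((a - d.2, a - d.1) : ℤ × ℤ) d).subset ?_
  rintro p ⟨hp, hp'⟩
  have h1 : a < p.1 + p.2 := by
    by_contra h
    exact hp' (ha p (not_lt.mp h))
  have h2 : p.1 ≤ d.1 := hp.1
  have h3 : p.2 ≤ d.2 := hp.2
  refine ⟨⟨?_, ?_⟩, hp⟩ <;> simp only <;> omega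

theorem weight_finsum {W : ℤ × ℤ → ℤ} (hW : InitiallyZero W) :
    weight (fun d => ∑ᶠ d' ∈ Set.Iic d, W d') = W := by
  have fin : ∀ (d : ℤ × ℤ) (s : Set (ℤ × ℤ)), s ⊆ Set.Iic d → (s ∩ Function.support W).Finite :=
    fun d s hs => (finite_Iic_inter_support hW d).subset (Set.inter_subset_inter_left _ hs)
  let R : ℤ → ℤ → Set (ℤ × ℤ) := fun x y => {p | p.1 = x ∧ p.2 ≤ y}
  have hR : ∀ x y, R x y ⊆ Set.Iic (x, y) := fun x y p hp => ⟨hp.1.le, hp.2⟩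
  have h1 : ∀ x y, ∑ᶠ p ∈ Set.Iic (x, y), W p =
      ∑ᶠ p ∈ Set.Iic (x - 1, y), W p + ∑ᶠ p ∈ R x y, W p := by
    intro x y
    rw [← finsum_mem_union']
    · congr! 3 with p
      simp only [R, Set.mem_Iic, Set.mem_union, Set.mem_ofPred_eq, Prod.le_def]
      omega
    · rw [Set.disjoint_left]
      intro p hp hp'
      have := hp.1
      have := hp'.1
      simp only at *
      omega
    · exact fin _ _ le_rfl
    · exact fin _ _ (hR x y)
  have h2 : ∀ x y, ∑ᶠ p ∈ R x y, W p = ∑ᶠ p ∈ R x (y - 1), W p + W (x, y) := by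
    intro x y
    rw [← finsum_mem_singleton (f := W) (a := (x, y)), ← finsum_mem_union']
    · congr! 3 with p
      simp only [R, Set.mem_singleton_iff, Set.mem_union, Set.mem_ofPred_eq, Prod.ext_iff]
      omega
    · rw [Set.disjoint_left]
      intro p hp hp'
      have := hp.2
      rw [Set.mem_singleton_iff] at hp'
      subst hp'
      simp only at *
      omega
    · exact fin _ _ (hR x (y - 1))
    · exact (Set.finite_singleton _).inter_of_left _
  funext ⟨x, y⟩
  simp only [weight]
  rw [h1 x y, h1 x (y - 1), h2 x y]
  ring

theorem eq_zero_of_weight_eq_zero {h : ℤ × ℤ → ℤ} (h0 : InitiallyZero h)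
    (hw : ∀ p, weight h p = 0) (p : ℤ × ℤ) : h p = 0 := by
  obtain ⟨a, ha⟩ := h0
  have key : ∀ N : ℕ, ∀ p : ℤ × ℤ, p.1 + p.2 ≤ a + N → h p = 0 := by
    intro N
    induction N with
    | zero => intro p hp; exact ha p (by simpa using hp)
    | succ N ih =>
      intro p hp
      push_cast at hp
      have e := hw p
      simp only [weight] at e
      rw [ih (p.1 - 1, p.2) (by simp only; omega), ih (p.1, p.2 - 1) (by simp only; omega),
        ih (p.1 - 1, p.2 - 1) (by simp only; omega)] at e
      simpa using e
  exact key (p.1 + p.2 - a).toNat p (by omega)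

/-- The weight of an initially zero `g` is the unique initially zero `W` with
`g d = ∑_{d' ≤ d} W d'`. -/
theorem isWeight_iff {g : ℤ × ℤ → ℤ} (hg : InitiallyZero g) (W : ℤ × ℤ → ℤ) :
    IsWeight g W ↔ W = weight g := by
  constructor
  · rintro ⟨hW, h⟩
    rw [show g = _ from funext h, weight_finsum hW]
  · rintro rfl
    have hW : InitiallyZero (weight g) := by
      obtain ⟨a, ha⟩ := hg
      refine ⟨a, fun p hp => ?_⟩
      simp only [weight]
      rw [ha p hp, ha (p.1 - 1, p.2) (by simp only; omega),
        ha (p.1, p.2 - 1) (by simp only; omega), ha (p.1 - 1, p.2 - 1) (by simp only; omega)]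
      ring
    refine ⟨hW, fun d => ?_⟩
    have hd : InitiallyZero (fun d => g d - ∑ᶠ d' ∈ Set.Iic d, weight g d') := by
      obtain ⟨a, ha⟩ := hg
      obtain ⟨b, hb⟩ := hW
      refine ⟨min a b, fun p hp => ?_⟩
      have : ∑ᶠ d' ∈ Set.Iic p, weight g d' = 0 := by
        refine finsum_mem_eq_zero_of_forall_eq_zero fun q hq => hb q ?_
        have := hq.1
        have := hq.2
        omega
      simp only [this, ha p (by omega), sub_zero]
    have := eq_zero_of_weight_eq_zero hd (fun p => by
      have e := congrFun (weight_finsum hW) p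
      simp only [weight] at e ⊢
      linarith) d
    linarith

/-- `W : ℤ² → ℤ` is bounded. -/
def IsBoundedWeight (W : ℤ × ℤ → ℤ) : Prop := ∃ C : ℤ, ∀ p, |W p| ≤ C

/-- A perfect matching: an initially and eventually zero `W : ℤ² → ℤ` that is the indicator
function of the graph of a permutation of `ℤ`. -/
def IsPerfectMatching (W : ℤ × ℤ → ℤ) : Prop :=
  InitiallyZero W ∧ EventuallyZero W ∧
    ∃ π : Equiv.Perm ℤ, ∀ i j : ℤ, W (i, j) = if j = π i then 1 else 0

/-- A way of writing `W = (W_1 + ⋯ + W_s) - (W̃_1 + ⋯ + W̃_{s-1})`, `s ≥ 1`, with perfect matchings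
`W_r`, `W̃_r`; here `s = m + 1`. -/
structure MatchingDecomposition (W : ℤ × ℤ → ℤ) where
  m : ℕ
  pos : Fin (m + 1) → ℤ × ℤ → ℤ
  neg : Fin m → ℤ × ℤ → ℤ
  pos_matching : ∀ r, IsPerfectMatching (pos r)
  neg_matching : ∀ r, IsPerfectMatching (neg r)
  sum_eq : ∀ p, W p = ∑ r, pos r p - ∑ r, neg r p

/-! ### `k`-diagrams -/

/-- The five positions of a `k`-diagram. -/
inductive Pos
  | B1 | B2 | B3 | A1 | A2

/-- The four arrows of a `k`-diagram. -/
inductive Arrow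
  | r11 | r22 | r31 | r32

/-- The source of an arrow. -/
@[reducible] def Arrow.src : Arrow → Pos
  | r11 => .B1
  | r22 => .B2
  | r31 => .B3
  | r32 => .B3

/-- The target of an arrow. -/
@[reducible] def Arrow.tgt : Arrow → Pos
  | r11 => .A1
  | r22 => .A2
  | r31 => .A1
  | r32 => .A2

/-- A `k`-diagram: five `k`-vector spaces and the four restriction maps
`B1 → A1`, `B2 → A2`, `B3 → A1`, `B3 → A2`. -/
structure KDiagram (k : Type u) [Field k] where
  val : Pos → Type u
  [acg : ∀ v, AddCommGroup (val v)]
  [mod : ∀ v, Module k (val v)]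
  res : ∀ e : Arrow, val e.src →ₗ[k] val e.tgt

attribute [instance] KDiagram.acg KDiagram.mod

namespace KDiagram

variable {k : Type u} [Field k]

/-- The differential
`∂ (b₁, b₂, b₃) = (ρ₁₁ b₁ - ρ₃₁ b₃, ρ₂₂ b₂ - ρ₃₂ b₃)`. -/
def diff (F : KDiagram k) :
    (F.val .B1 × F.val .B2 × F.val .B3) →ₗ[k] (F.val .A1 × F.val .A2) :=
  let b1 : (F.val .B1 × F.val .B2 × F.val .B3) →ₗ[k] F.val .B1 := LinearMap.fst k _ _
  let b2 : (F.val .B1 × F.val .B2 × F.val .B3) →ₗ[k] F.val .B2 :=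
    LinearMap.fst k _ _ ∘ₗ LinearMap.snd k _ _
  let b3 : (F.val .B1 × F.val .B2 × F.val .B3) →ₗ[k] F.val .B3 :=
    LinearMap.snd k _ _ ∘ₗ LinearMap.snd k _ _
  let ρ11 : F.val .B1 →ₗ[k] F.val .A1 := F.res .r11
  let ρ22 : F.val .B2 →ₗ[k] F.val .A2 := F.res .r22
  let ρ31 : F.val .B3 →ₗ[k] F.val .A1 := F.res .r31
  let ρ32 : F.val .B3 →ₗ[k] F.val .A2 := F.res .r32
  LinearMap.prod (ρ11 ∘ₗ b1 - ρ31 ∘ₗ b3) (ρ22 ∘ₗ b2 - ρ32 ∘ₗ b3)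

/-- A `k`-diagram is Fredholm if both cohomology groups `H⁰ = ker ∂` and `H¹ = coker ∂` are
finite dimensional. -/
def IsFredholm (F : KDiagram k) : Prop :=
  FiniteDimensional k (LinearMap.ker F.diff) ∧
    FiniteDimensional k ((F.val .A1 × F.val .A2) ⧸ LinearMap.range F.diff)

/-- An isomorphism of `k`-diagrams: linear isomorphisms of all values that commute with the
restriction maps. -/
structure Iso (F G : KDiagram k) where
  app : ∀ v, F.val v ≃ₗ[k] G.val v
  comm : ∀ (e : Arrow) (x : F.val e.src), G.res e (app e.src x) = app e.tgt (F.res e x)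

/-- The direct sum of two `k`-diagrams. -/
def sum (F G : KDiagram k) : KDiagram k where
  val v := F.val v × G.val v
  res e := LinearMap.prodMap (F.res e) (G.res e)

/-- The direct sum of a family of `k`-diagrams. -/
def directSum {L : Type} (F : L → KDiagram k) : KDiagram k where
  val v := DirectSum L fun l => (F l).val v
  res e := DirectSum.lmap fun l => (F l).res e

end KDiagram

/-- The multiset on `ℤ × ℤ` with (non-negative) multiplicities `W`, as a set of triples. -/
def Multi (W : ℤ × ℤ → ℤ) : Type :=
  {q : ℤ × ℤ × ℕ // 1 ≤ q.2.2 ∧ (q.2.2 : ℤ) ≤ W (q.1, q.2.1)}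

/-- The index sets of the standard bases of the values of `M_{W,d}`. -/
def modelIndex (W : ℤ × ℤ → ℤ) (d : ℤ × ℤ) : Pos → Type
  | .B1 => {a : ℤ // a ≤ d.1}
  | .B2 => {a : ℤ // a ≤ d.2}
  | .B3 => Multi W
  | .A1 => ℤ
  | .A2 => ℤ

/-- The maps of bases that induce the restriction maps of `M_{W,d}`: the two inclusions, and the
first and second projections of `Multi W`. -/
def modelMap (W : ℤ × ℤ → ℤ) (d : ℤ × ℤ) : ∀ e : Arrow, modelIndex W d e.src → modelIndex W d e.tgt
  | .r11 => fun a : {a : ℤ // a ≤ d.1} => a.1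
  | .r22 => fun a : {a : ℤ // a ≤ d.2} => a.1
  | .r31 => fun q : Multi W => q.1.1
  | .r32 => fun q : Multi W => q.1.2.1

/-- The `k`-diagram `M_{W,d}` of a non-negative `W : ℤ² → ℤ` and `d ∈ ℤ²`. -/
noncomputable def modelDiagram (k : Type u) [Field k] (W : ℤ × ℤ → ℤ) (d : ℤ × ℤ) :
    KDiagram k where
  val v := modelIndex W d v →₀ k
  res e := Finsupp.lmapDomain k k (modelMap W d e)

/-! ### Virtual `k`-diagrams -/

/-- A formal difference `plus ⊖ minus` of `k`-diagrams. -/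
structure VirtualDiagram (k : Type u) [Field k] where
  plus : KDiagram k
  minus : KDiagram k

namespace VirtualDiagram

variable {k : Type u} [Field k]

/-- Both parts are Fredholm. -/
def IsFredholm (V : VirtualDiagram k) : Prop := V.plus.IsFredholm ∧ V.minus.IsFredholm

/-- Equivalence of virtual Fredholm `k`-diagrams: `F₁ ⊖ F₂ ∼ F₁' ⊖ F₂'` if
`F₁ ⊕ F₂' ⊕ F₀ ≃ F₁' ⊕ F₂ ⊕ F₀` for some Fredholm `F₀`; everything that occurs has to be
Fredholm. -/
def Equivalent (V V' : VirtualDiagram k) : Prop :=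
  V.IsFredholm ∧ V'.IsFredholm ∧ ∃ F₀ : KDiagram k, F₀.IsFredholm ∧
    Nonempty (KDiagram.Iso ((V.plus.sum V'.minus).sum F₀) ((V'.plus.sum V.minus).sum F₀))

end VirtualDiagram

/-- The virtual `k`-diagram `(M_{W_1,d} ⊕ ⋯ ⊕ M_{W_s,d}) ⊖ (M_{W̃_1,d} ⊕ ⋯ ⊕ M_{W̃_{s-1},d})` of a
decomposition of `W`. -/
noncomputable def MatchingDecomposition.virtual (k : Type u) [Field k] {W : ℤ × ℤ → ℤ}
    (D : MatchingDecomposition W) (d : ℤ × ℤ) : VirtualDiagram k where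
  plus := KDiagram.directSum fun r => modelDiagram k (D.pos r) d
  minus := KDiagram.directSum fun r => modelDiagram k (D.neg r) d

/-- The class `[M_{W,d}]`: all virtual Fredholm `k`-diagrams that are equivalent to the virtual
diagram of some decomposition of `W`. (That this is a single equivalence class is part of the
theorem; it is empty if `W` has no decomposition.) -/
def virtualClass (k : Type u) [Field k] (W : ℤ × ℤ → ℤ) (d : ℤ × ℤ) : Set (VirtualDiagram k) :=
  {V | ∃ D : MatchingDecomposition W, V.Equivalent (D.virtual k d)}

/-- `W_{f;i,j,d}`, the weight of the two-variable restriction `f_{i,j,d}`. -/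
def restrictionWeight {n : ℕ} (f : (Fin n → ℤ) → ℤ) (i j : Fin n) (d : Fin n → ℤ) :
    ℤ × ℤ → ℤ :=
  weight (twoVar f i j d)

/-- The class `[M_{f;i,j,d}] = [M_{W,0}]` with `W = W_{f;i,j,d}`. -/
def restrictionClass (k : Type u) [Field k] {n : ℕ} (f : (Fin n → ℤ) → ℤ) (i j : Fin n)
    (d : Fin n → ℤ) : Set (VirtualDiagram k) :=
  virtualClass k (restrictionWeight f i j d) (0, 0)

/-! Existence of (*). A two-variable restriction of `f` is zero in small degree and affine in large
degree, so its weight, a mixed second difference, is supported in a band `lo < x + y ≤ hi` and has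
all row and column sums equal to one. If it is bounded by `C`, adding `C` on the whole band makes it
nonnegative. The sum and the added constant are then regular bipartite multigraphs with finite
degrees, and `exists_perfectMatchings` peels perfect matchings off each of them by Hall's theorem.
Conversely, a finite combination of matchings is bounded.

Independence. The diagram of a perfect matching `π` at `(0, 0)` splits over its edges `(x, π x)`
into elementary diagrams of four types, according to the signs of the two ends
(`directSumModelIso`). The band condition leaves only finitely many edges with both ends `≤ 0` or
both ends `> 0`, which gives Fredholmness, whereas each mixed type occurs countably infinitely
often. A nonempty finite sum of matchings is therefore determined up to isomorphism by two natural
numbers (`nonempty_iso_edgeDiagram`). These numbers are sums of the matchings over large squares,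
hence additive, so the virtual class depends only on the sums of `W` over `(-N, 0]²` and `(0, N]²`
for large `N` (`equivalent_virtual`). For the weight of `f_{i,j,d}` they equal `f d` and `f d - deg
d - C`, in which `i` and `j` do not occur (`eventually_boxSum_restrictionWeight`). -/

/-! ### Linear maps with finite-dimensional kernel and cokernel -/

/-- A linear map with finite-dimensional kernel and cokernel. -/
def LinearMap.HasFiniteIndex {k V W : Type*} [Field k] [AddCommGroup V] [Module k V]
    [AddCommGroup W] [Module k W] (T : V →ₗ[k] W) : Prop :=
  FiniteDimensional k (LinearMap.ker T) ∧ FiniteDimensional k (W ⧸ LinearMap.range T)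

section HasFiniteIndex

variable {k V W V' W' : Type*} [Field k] [AddCommGroup V] [Module k V] [AddCommGroup W]
  [Module k W] [AddCommGroup V'] [Module k V'] [AddCommGroup W'] [Module k W']

theorem LinearMap.HasFiniteIndex.conj {T : V →ₗ[k] W} {T' : V' →ₗ[k] W'}
    (hT : T.HasFiniteIndex) (e : V ≃ₗ[k] V') (g : W ≃ₗ[k] W')
    (h : ∀ x, T' (e x) = g (T x)) : T'.HasFiniteIndex := by
  obtain ⟨h₁, h₂⟩ := hT
  have hker : (LinearMap.ker T).map (e : V →ₗ[k] V') = LinearMap.ker T' := by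
    ext y
    simp only [Submodule.mem_map, LinearMap.mem_ker, LinearEquiv.coe_coe]
    constructor
    · rintro ⟨x, hx, rfl⟩
      rw [h, hx, map_zero]
    · intro hy
      refine ⟨e.symm y, ?_, e.apply_symm_apply y⟩
      apply g.injective
      rw [← h, e.apply_symm_apply, hy, map_zero]
  have hrange : (LinearMap.range T).map (g : W →ₗ[k] W') = LinearMap.range T' := by
    ext y
    simp only [Submodule.mem_map, LinearMap.mem_range, LinearEquiv.coe_coe]
    constructor
    · rintro ⟨_, ⟨x, rfl⟩, rfl⟩
      exact ⟨e x, h x⟩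
    · rintro ⟨x, rfl⟩
      exact ⟨_, ⟨e.symm x, rfl⟩, by rw [← h, e.apply_symm_apply]⟩
  refine ⟨?_, ?_⟩
  · rw [← hker]
    exact Module.Finite.equiv (e.submoduleMap (LinearMap.ker T))
  · exact Module.Finite.equiv (Submodule.Quotient.equiv _ _ g hrange)

theorem LinearMap.HasFiniteIndex.prodMap {T : V →ₗ[k] W} {T' : V' →ₗ[k] W'}
    (hT : T.HasFiniteIndex) (hT' : T'.HasFiniteIndex) : (T.prodMap T').HasFiniteIndex := by
  obtain ⟨h₁, h₂⟩ := hT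
  obtain ⟨h₃, h₄⟩ := hT'
  constructor
  · let φ : LinearMap.ker (T.prodMap T') →ₗ[k] LinearMap.ker T × LinearMap.ker T' :=
      LinearMap.prod
        (LinearMap.codRestrict _ (LinearMap.fst k V V' ∘ₗ Submodule.subtype _)
          fun x => congrArg Prod.fst x.2)
        (LinearMap.codRestrict _ (LinearMap.snd k V V' ∘ₗ Submodule.subtype _)
          fun x => congrArg Prod.snd x.2)
    refine Module.Finite.of_injective φ fun x y hxy => ?_
    apply Subtype.ext
    apply Prod.ext
    · exact congrArg (fun z => (z.1 : V)) hxy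
    · exact congrArg (fun z => (z.2 : V')) hxy
  · let q := (LinearMap.range (T.prodMap T')).mkQ
    let φ₁ : (W ⧸ LinearMap.range T) →ₗ[k] _ :=
      (LinearMap.range T).liftQ (q ∘ₗ LinearMap.inl k W W') (by
        rintro _ ⟨x, rfl⟩
        simp only [q, LinearMap.mem_ker, LinearMap.comp_apply, Submodule.mkQ_apply,
          Submodule.Quotient.mk_eq_zero]
        exact ⟨(x, 0), by simp⟩)
    let φ₂ : (W' ⧸ LinearMap.range T') →ₗ[k] _ :=
      (LinearMap.range T').liftQ (q ∘ₗ LinearMap.inr k W W') (by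
        rintro _ ⟨x, rfl⟩
        simp only [q, LinearMap.mem_ker, LinearMap.comp_apply, Submodule.mkQ_apply,
          Submodule.Quotient.mk_eq_zero]
        exact ⟨(0, x), by simp⟩)
    refine Module.Finite.of_surjective (φ₁.coprod φ₂) fun z => ?_
    obtain ⟨⟨w, w'⟩, rfl⟩ := Submodule.mkQ_surjective _ z
    refine ⟨(Submodule.Quotient.mk w, Submodule.Quotient.mk w'), ?_⟩
    change q (w, 0) + q (0, w') = q (w, w')
    rw [← map_add]
    simp

end HasFiniteIndex

/-! ### Isomorphism classes of `k`-diagrams -/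

namespace KDiagram

variable {k : Type u} [Field k]

theorem diff_apply (F : KDiagram k) (b₁ : F.val .B1) (b₂ : F.val .B2) (b₃ : F.val .B3) :
    F.diff (b₁, b₂, b₃) = (F.res .r11 b₁ - F.res .r31 b₃, F.res .r22 b₂ - F.res .r32 b₃) :=
  rfl

namespace Iso

/-- The identity. -/
def refl (F : KDiagram k) : Iso F F where
  app _ := LinearEquiv.refl k _
  comm _ _ := rfl

/-- The inverse of an isomorphism. -/
def symm {F G : KDiagram k} (φ : Iso F G) : Iso G F where
  app v := (φ.app v).symm
  comm e x := by
    apply (φ.app e.tgt).injective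
    rw [← φ.comm, LinearEquiv.apply_symm_apply, LinearEquiv.apply_symm_apply]

/-- The composition of isomorphisms. -/
def trans {F G H : KDiagram k} (φ : Iso F G) (ψ : Iso G H) : Iso F H where
  app v := (φ.app v).trans (ψ.app v)
  comm e x := by
    simp only [LinearEquiv.trans_apply]
    rw [ψ.comm, φ.comm]

/-- The direct sum of two isomorphisms. -/
def sumCongr {F G F' G' : KDiagram k} (φ : Iso F F') (ψ : Iso G G') :
    Iso (F.sum G) (F'.sum G') where
  app v := (φ.app v).prodCongr (ψ.app v)
  comm e x := Prod.ext (φ.comm e x.1) (ψ.comm e x.2)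

/-- Commutativity of the direct sum. -/
def sumComm (F G : KDiagram k) : Iso (F.sum G) (G.sum F) where
  app _ := LinearEquiv.prodComm k _ _
  comm _ _ := rfl

/-- Associativity of the direct sum. -/
def sumAssoc (F G H : KDiagram k) : Iso ((F.sum G).sum H) (F.sum (G.sum H)) where
  app _ := LinearEquiv.prodAssoc k _ _ _
  comm _ _ := rfl

theorem isFredholm {F G : KDiagram k} (φ : Iso F G) (hF : F.IsFredholm) : G.IsFredholm := by
  refine LinearMap.HasFiniteIndex.conj (T := F.diff) (T' := G.diff) hF
    ((φ.app .B1).prodCongr ((φ.app .B2).prodCongr (φ.app .B3)))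
    ((φ.app .A1).prodCongr (φ.app .A2)) ?_
  rintro ⟨b₁, b₂, b₃⟩
  have h₁ := φ.comm .r11 b₁
  have h₂ := φ.comm .r22 b₂
  have h₃ := φ.comm .r31 b₃
  have h₄ := φ.comm .r32 b₃
  simp only [LinearEquiv.prodCongr_apply, diff_apply, map_sub]
  exact Prod.ext (congrArg₂ (· - ·) h₁ h₃) (congrArg₂ (· - ·) h₂ h₄)

end Iso

theorem IsFredholm.sum {F G : KDiagram k} (hF : F.IsFredholm) (hG : G.IsFredholm) :
    (F.sum G).IsFredholm := by
  have h := LinearMap.HasFiniteIndex.prodMap (T := F.diff) (T' := G.diff) hF hG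
  exact h.conj (T' := (F.sum G).diff)
    { toFun := fun x => ((x.1.1, x.2.1), (x.1.2.1, x.2.2.1), (x.1.2.2, x.2.2.2))
      invFun := fun x => ((x.1.1, x.2.1.1, x.2.2.1), (x.1.2, x.2.1.2, x.2.2.2))
      map_add' := fun _ _ => rfl
      map_smul' := fun _ _ => rfl
      left_inv := fun _ => rfl
      right_inv := fun _ => rfl }
    { toFun := fun x => ((x.1.1, x.2.1), (x.1.2, x.2.2))
      invFun := fun x => ((x.1.1, x.2.1), (x.1.2, x.2.2))
      map_add' := fun _ _ => rfl
      map_smul' := fun _ _ => rfl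
      left_inv := fun _ => rfl
      right_inv := fun _ => rfl }
    (fun _ => rfl)

/-- Isomorphism of `k`-diagrams as an equivalence relation. -/
instance isoSetoid (k : Type u) [Field k] : Setoid (KDiagram k) where
  r F G := Nonempty (Iso F G)
  iseqv :=
    { refl := fun F => ⟨Iso.refl F⟩
      symm := fun ⟨φ⟩ => ⟨φ.symm⟩
      trans := fun ⟨φ⟩ ⟨ψ⟩ => ⟨φ.trans ψ⟩ }

/-- Isomorphism classes of `k`-diagrams. -/
def IsoClass (k : Type u) [Field k] : Type (u + 1) := Quotient (isoSetoid k)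

/-- The isomorphism class of a `k`-diagram. -/
def cls (F : KDiagram k) : IsoClass k := Quotient.mk _ F

theorem cls_eq_cls {F G : KDiagram k} : F.cls = G.cls ↔ Nonempty (Iso F G) := Quotient.eq

/-- Rearranging direct sums becomes arithmetic in a commutative semigroup, so that `ac_rfl` applies.
Cancellation does not come with it. -/
instance : AddCommSemigroup (IsoClass k) where
  add := Quotient.map₂ sum fun _ _ ⟨φ⟩ _ _ ⟨ψ⟩ => ⟨φ.sumCongr ψ⟩
  add_assoc := by
    rintro ⟨F⟩ ⟨G⟩ ⟨H⟩
    exact Quotient.sound ⟨Iso.sumAssoc F G H⟩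
  add_comm := by
    rintro ⟨F⟩ ⟨G⟩
    exact Quotient.sound ⟨Iso.sumComm F G⟩

theorem cls_sum (F G : KDiagram k) : (F.sum G).cls = F.cls + G.cls := rfl

end KDiagram

namespace VirtualDiagram

variable {k : Type u} [Field k]

theorem equivalent_iff {V V' : VirtualDiagram k} :
    V.Equivalent V' ↔ V.IsFredholm ∧ V'.IsFredholm ∧ ∃ F₀ : KDiagram k, F₀.IsFredholm ∧
      V.plus.cls + V'.minus.cls + F₀.cls = V'.plus.cls + V.minus.cls + F₀.cls := by
  simp only [Equivalent, ← KDiagram.cls_eq_cls, KDiagram.cls_sum]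

theorem Equivalent.symm {V V' : VirtualDiagram k} (h : V.Equivalent V') : V'.Equivalent V := by
  obtain ⟨h₁, h₂, F, hF, ⟨φ⟩⟩ := h
  exact ⟨h₂, h₁, F, hF, ⟨φ.symm⟩⟩

theorem Equivalent.trans {V V' V'' : VirtualDiagram k} (h : V.Equivalent V')
    (h' : V'.Equivalent V'') : V.Equivalent V'' := by
  rw [equivalent_iff] at *
  obtain ⟨h₁, h₂, F, hF, e⟩ := h
  obtain ⟨-, h₃, G, hG, e'⟩ := h'
  -- The two halves of `V'` cannot be cancelled after adding the two isomorphisms, so they are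
  -- absorbed into the stabilizing diagram.
  refine ⟨h₁, h₃, (V'.plus.sum V'.minus).sum (F.sum G), (h₂.1.sum h₂.2).sum (hF.sum hG), ?_⟩
  simp only [KDiagram.cls_sum]
  calc V.plus.cls + V''.minus.cls + (V'.plus.cls + V'.minus.cls + (F.cls + G.cls))
      = (V.plus.cls + V'.minus.cls + F.cls) + (V'.plus.cls + V''.minus.cls + G.cls) := by
        ac_rfl
    _ = (V'.plus.cls + V.minus.cls + F.cls) + (V''.plus.cls + V'.minus.cls + G.cls) := by
        rw [e, e']
    _ = _ := by ac_rfl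

theorem setOf_equivalent_eq {V V' : VirtualDiagram k} (h : V.Equivalent V') :
    {U : VirtualDiagram k | U.Equivalent V} = {U | U.Equivalent V'} :=
  Set.ext fun _ => ⟨fun hU => hU.trans h, fun hU => hU.trans h.symm⟩

end VirtualDiagram

/-! ### Diagrams with compatible bases -/

section Finsupp

variable {k : Type*} [Field k]

theorem Finsupp.sumFinsuppLEquivProdFinsupp_mapDomain {α β α' β' : Type*} (f : α → α')
    (g : β → β') (x : α ⊕ β →₀ k) :
    Finsupp.sumFinsuppLEquivProdFinsupp k (Finsupp.mapDomain (Sum.map f g) x) =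
      (Finsupp.lmapDomain k k f).prodMap (Finsupp.lmapDomain k k g)
        (Finsupp.sumFinsuppLEquivProdFinsupp k x) := by
  induction x using Finsupp.induction_linear with
  | zero => simp
  | add x y hx hy => rw [Finsupp.mapDomain_add, map_add, hx, hy, map_add, map_add]
  | single c r =>
    rcases c with c | c <;> simp [Finsupp.mapDomain_single]

theorem sigmaFinsuppLequivDFinsupp_mapDomain {L : Type*} {α β : L → Type*}
    (f : ∀ l, α l → β l) (x : (Σ l, α l) →₀ k) :
    sigmaFinsuppLequivDFinsupp k (Finsupp.mapDomain (Sigma.map id f) x) =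
      DirectSum.lmap (fun l => Finsupp.lmapDomain k k (f l))
        (sigmaFinsuppLequivDFinsupp k x) := by
  classical
  induction x using Finsupp.induction_linear with
  | zero => rw [Finsupp.mapDomain_zero, map_zero, map_zero, map_zero]
  | add x y hx hy => rw [Finsupp.mapDomain_add, map_add, hx, hy, map_add, map_add]
  | single c r =>
    rw [Finsupp.mapDomain_single]
    refine (sigmaFinsuppEquivDFinsupp_single (Sigma.map id f c) r).trans ?_
    refine Eq.symm ((congrArg _ (sigmaFinsuppEquivDFinsupp_single c r)).trans ?_)
    refine ((DirectSum.lmap_lof (R := k) (fun l => Finsupp.lmapDomain k k (f l)) c.1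
      (Finsupp.single c.2 r)).trans ?_)
    rw [Finsupp.lmapDomain_apply, Finsupp.mapDomain_single]
    rfl

theorem Finsupp.mapDomain_equivMapDomain_of_comm {α β α' β' : Type*} {f : α → β}
    {f' : α' → β'} {φ : α ≃ α'} {ψ : β ≃ β'} (h : ∀ a, f' (φ a) = ψ (f a)) (x : α →₀ k) :
    Finsupp.mapDomain f' (Finsupp.equivMapDomain φ x) =
      Finsupp.equivMapDomain ψ (Finsupp.mapDomain f x) := by
  rw [Finsupp.equivMapDomain_eq_mapDomain, Finsupp.equivMapDomain_eq_mapDomain,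
    ← Finsupp.mapDomain_comp, ← Finsupp.mapDomain_comp]
  exact congrArg (fun g => Finsupp.mapDomain g x) (funext h)

end Finsupp

namespace KDiagram

variable (k : Type u) [Field k]

/-- The `k`-diagram freely spanned by a diagram of sets. -/
noncomputable def free (S : Pos → Type) (m : ∀ e : Arrow, S e.src → S e.tgt) : KDiagram k where
  val v := S v →₀ k
  res e := Finsupp.lmapDomain k k (m e)

variable {k}

/-- Isomorphic diagrams of sets span isomorphic `k`-diagrams. -/
noncomputable def freeCongr {S S' : Pos → Type} {m : ∀ e : Arrow, S e.src → S e.tgt}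
    {m' : ∀ e : Arrow, S' e.src → S' e.tgt} (φ : ∀ v, S v ≃ S' v)
    (h : ∀ e x, m' e (φ _ x) = φ _ (m e x)) : Iso (free k S m) (free k S' m') where
  app v := Finsupp.domLCongr (φ v)
  comm e x := Finsupp.mapDomain_equivMapDomain_of_comm (h e) x

/-- The direct sum of two free diagrams is free. -/
noncomputable def freeSum {S S' : Pos → Type} (m : ∀ e : Arrow, S e.src → S e.tgt)
    (m' : ∀ e : Arrow, S' e.src → S' e.tgt) :
    Iso (free k (fun v => S v ⊕ S' v) fun e => Sum.map (m e) (m' e))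
      ((free k S m).sum (free k S' m')) where
  app _ := Finsupp.sumFinsuppLEquivProdFinsupp k
  comm e x := (Finsupp.sumFinsuppLEquivProdFinsupp_mapDomain (m e) (m' e) x).symm

/-- A direct sum of free diagrams is free. -/
noncomputable def freeDirectSum {L : Type} {S : L → Pos → Type}
    (m : ∀ l, ∀ e : Arrow, S l e.src → S l e.tgt) :
    Iso (free k (fun v => Σ l, S l v) fun e => Sigma.map id fun l => m l e)
      (directSum fun l => free k (S l) (m l)) where
  app _ := sigmaFinsuppLequivDFinsupp k
  comm e x := (sigmaFinsuppLequivDFinsupp_mapDomain (fun l => m l e) x).symm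

/-! ### Sums of edges -/

/-- The bases of the diagram of a set `E` of edges, whose ends on the two sides lie in `B1`,
respectively `B2`, according to `p₁` and `p₂`. -/
def edgeIndex {E : Type} (p₁ p₂ : E → Prop) : Pos → Type
  | .B1 => {e // p₁ e}
  | .B2 => {e // p₂ e}
  | .B3 => E
  | .A1 => E
  | .A2 => E

/-- The maps between the bases of the diagram of a set of edges. -/
def edgeMap {E : Type} (p₁ p₂ : E → Prop) :
    ∀ a : Arrow, edgeIndex p₁ p₂ a.src → edgeIndex p₁ p₂ a.tgt
  | .r11 => fun e : {e // p₁ e} => e.1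
  | .r22 => fun e : {e // p₂ e} => e.1
  | .r31 => fun e : E => e
  | .r32 => fun e : E => e

/-- The direct sum, over a set `E` of edges, of the diagrams with `B3 = A1 = A2 = k`, with
`B1 = k` or `0` according to `p₁` and `B2 = k` or `0` according to `p₂`. -/
noncomputable def edgeDiagram (k : Type u) [Field k] {E : Type} (p₁ p₂ : E → Prop) :
    KDiagram k :=
  free k (edgeIndex p₁ p₂) (edgeMap p₁ p₂)

/-- A bijection of edges that preserves their types induces an isomorphism. -/
noncomputable def edgeCongr {E E' : Type} {p₁ p₂ : E → Prop} {p₁' p₂' : E' → Prop}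
    (φ : E ≃ E') (h₁ : ∀ e, p₁ e ↔ p₁' (φ e)) (h₂ : ∀ e, p₂ e ↔ p₂' (φ e)) :
    Iso (edgeDiagram k p₁ p₂) (edgeDiagram k p₁' p₂') :=
  freeCongr
    (fun
      | .B1 => φ.subtypeEquiv h₁
      | .B2 => φ.subtypeEquiv h₂
      | .B3 => φ
      | .A1 => φ
      | .A2 => φ)
    (by rintro (_ | _ | _ | _) x <;> rfl)

/-- The direct sum of two edge diagrams is an edge diagram. -/
noncomputable def edgeSum {E E' : Type} (p₁ p₂ : E → Prop) (p₁' p₂' : E' → Prop) :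
    Iso (edgeDiagram k (Sum.elim p₁ p₁') (Sum.elim p₂ p₂'))
      ((edgeDiagram k p₁ p₂).sum (edgeDiagram k p₁' p₂')) :=
  Iso.trans (G := free k (fun v => edgeIndex p₁ p₂ v ⊕ edgeIndex p₁' p₂' v)
      fun a => Sum.map (edgeMap p₁ p₂ a) (edgeMap p₁' p₂' a))
    (freeCongr
      (fun
        | .B1 => Equiv.subtypeSum
        | .B2 => Equiv.subtypeSum
        | .B3 => Equiv.refl _
        | .A1 => Equiv.refl _
        | .A2 => Equiv.refl _)
      (by
        rintro (_ | _ | _ | _) x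
        · rcases x with ⟨x | x, hx⟩ <;> rfl
        · rcases x with ⟨x | x, hx⟩ <;> rfl
        · rcases x with x | x <;> rfl
        · rcases x with x | x <;> rfl))
    (freeSum _ _)

/-- Pairs in a sigma type whose second component satisfies a condition. -/
def sigmaSubtypeEquiv {L X : Type} (p : L → X → Prop) :
    (Σ l, {x // p l x}) ≃ {e : Σ _ : L, X // p e.1 e.2} where
  toFun e := ⟨⟨e.1, e.2.1⟩, e.2.2⟩
  invFun e := ⟨e.1.1, ⟨e.1.2, e.2⟩⟩

/-- The edges of a perfect matching are indexed by their first end. -/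
def multiEquiv {W : ℤ × ℤ → ℤ} {π : Equiv.Perm ℤ}
    (hW : ∀ i j : ℤ, W (i, j) = if j = π i then 1 else 0) : Multi W ≃ ℤ where
  toFun q := q.1.1
  invFun x := ⟨(x, π x, 1), by simp [hW]⟩
  left_inv := by
    rintro ⟨⟨x, y, n⟩, hn, hn'⟩
    apply Subtype.ext
    simp only [hW] at hn hn' ⊢
    split_ifs at hn' with h
    · subst h
      have : n = 1 := by omega
      rw [this]
    · omega
  right_inv _ := rfl

theorem apply_multiEquiv {W : ℤ × ℤ → ℤ} {π : Equiv.Perm ℤ}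
    (hW : ∀ i j : ℤ, W (i, j) = if j = π i then 1 else 0) (q : Multi W) :
    π (multiEquiv hW q) = q.1.2.1 := by
  obtain ⟨x, rfl⟩ := (multiEquiv hW).symm.surjective q
  rw [Equiv.apply_symm_apply]
  rfl

/-- A direct sum of diagrams of perfect matchings is the direct sum of the edges. -/
noncomputable def directSumModelIso {L : Type} {W : L → ℤ × ℤ → ℤ} {π : L → Equiv.Perm ℤ}
    (hW : ∀ l, ∀ i j : ℤ, W l (i, j) = if j = π l i then 1 else 0) (d : ℤ × ℤ) :
    Iso (directSum fun l => modelDiagram k (W l) d)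
      (edgeDiagram k (fun e : Σ _ : L, ℤ => e.2 ≤ d.1) fun e => π e.1 e.2 ≤ d.2) :=
  Iso.trans (freeDirectSum fun l => modelMap (W l) d).symm
    (freeCongr
      (fun
        | .B1 => sigmaSubtypeEquiv fun _ x => x ≤ d.1
        | .B2 => (Equiv.sigmaCongrRight fun l =>
            (π l).symm.subtypeEquiv fun a => by simp).trans
              (sigmaSubtypeEquiv fun l x => π l x ≤ d.2)
        | .B3 => Equiv.sigmaCongrRight fun l => multiEquiv (hW l)
        | .A1 => Equiv.refl _
        -- Relabelling the basis of `A2` by the first end of the edge that arrives there turns both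
        -- maps out of `B3` into identities.
        | .A2 => Equiv.sigmaCongrRight fun l => (π l).symm)
      (by
        rintro (_ | _ | _ | _) x
        · rfl
        · rfl
        · rfl
        · exact Sigma.ext rfl (heq_of_eq
            ((Equiv.eq_symm_apply _).2 (apply_multiEquiv (hW x.1) x.2)))))

/-- The differential splits over the edges. An edge with both `p₁` and `p₂` contributes a line to
the kernel, an edge with neither contributes a line to the cokernel, and a mixed edge contributes
nothing. -/
theorem isFredholm_edgeDiagram {E : Type} {p₁ p₂ : E → Prop}
    (h : {e | p₁ e ∧ p₂ e}.Finite) (h' : {e | ¬ p₁ e ∧ ¬ p₂ e}.Finite) :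
    (edgeDiagram k p₁ p₂).IsFredholm := by
  classical
  let i₁ : ({e // p₁ e} →₀ k) →ₗ[k] (E →₀ k) := Finsupp.lmapDomain k k Subtype.val
  let i₂ : ({e // p₂ e} →₀ k) →ₗ[k] (E →₀ k) := Finsupp.lmapDomain k k Subtype.val
  let i₃ : (E →₀ k) →ₗ[k] (E →₀ k) := Finsupp.lmapDomain k k fun e => e
  have hi₃ : ∀ x, i₃ x = x := fun x => Finsupp.mapDomain_id
  have hi₁ : ∀ x e, ¬ p₁ e → i₁ x e = 0 := fun x e he =>
    Finsupp.mapDomain_of_notMem_range _ _ (by simpa using he)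
  have hi₂ : ∀ x e, ¬ p₂ e → i₂ x e = 0 := fun x e he =>
    Finsupp.mapDomain_of_notMem_range _ _ (by simpa using he)
  have hs₁ : ∀ e (he : p₁ e), i₁ (Finsupp.single ⟨e, he⟩ 1) = Finsupp.single e 1 :=
    fun e he => Finsupp.mapDomain_single
  have hs₂ : ∀ e (he : p₂ e), i₂ (Finsupp.single ⟨e, he⟩ 1) = Finsupp.single e 1 :=
    fun e he => Finsupp.mapDomain_single
  let T : (({e // p₁ e} →₀ k) × ({e // p₂ e} →₀ k) × (E →₀ k)) →ₗ[k] ((E →₀ k) × (E →₀ k)) :=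
    (edgeDiagram k p₁ p₂).diff
  have hT : ∀ b₁ b₂ b₃, T (b₁, b₂, b₃) = (i₁ b₁ - b₃, i₂ b₂ - b₃) := by
    intro b₁ b₂ b₃
    change (i₁ b₁ - i₃ b₃, i₂ b₂ - i₃ b₃) = _
    rw [hi₃]
  suffices H : T.HasFiniteIndex from H
  clear_value T
  constructor
  · have : Finite {e // p₁ e ∧ p₂ e} := h.to_subtype
    -- On the kernel `b₃ = i₁ b₁ = i₂ b₂`, so `b₃` is supported on the edges with both properties
    -- and determines `b₁` and `b₂`.
    let φ : LinearMap.ker T →ₗ[k] ({e // p₁ e ∧ p₂ e} → k) :=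
      LinearMap.pi fun e => Finsupp.lapply e.1 ∘ₗ LinearMap.snd k _ _ ∘ₗ LinearMap.snd k _ _ ∘ₗ
        Submodule.subtype _
    suffices H : ∀ x, φ x = 0 → x = 0 from Module.Finite.of_injective φ fun x y hxy =>
      sub_eq_zero.1 (H (x - y) ((LinearMap.map_sub φ x y).trans (sub_eq_zero.2 hxy)))
    rintro ⟨⟨b₁, b₂, b₃⟩, hb⟩ h0
    rw [LinearMap.mem_ker, hT, Prod.mk_eq_zero, sub_eq_zero, sub_eq_zero] at hb
    have hb₃ : b₃ = 0 := by
      ext e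
      by_cases h₁ : p₁ e
      · by_cases h₂ : p₂ e
        · exact congrFun h0 ⟨e, h₁, h₂⟩
        · rw [← hb.2, hi₂ _ _ h₂]
          rfl
      · rw [← hb.1, hi₁ _ _ h₁]
        rfl
    subst hb₃
    have e₁ : b₁ = 0 := Finsupp.mapDomain_injective Subtype.val_injective
      (hb.1.trans (map_zero i₁).symm)
    have e₂ : b₂ = 0 := Finsupp.mapDomain_injective Subtype.val_injective
      (hb.2.trans (map_zero i₂).symm)
    subst e₁ e₂
    rfl
  · let q := (LinearMap.range T).mkQ
    have hq : ∀ b₁ b₂ b₃, q (i₁ b₁ - b₃, i₂ b₂ - b₃) = 0 := fun b₁ b₂ b₃ => by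
      rw [← hT]
      exact (Submodule.Quotient.mk_eq_zero _).2 ⟨_, rfl⟩
    let s : E → (E →₀ k) := fun e => Finsupp.single e 1
    let P := Submodule.span k ((fun e => q (0, s e)) '' {e | ¬ p₁ e ∧ ¬ p₂ e})
    -- The class of `(0, e)` dies if `p₁ e` (take `b₁ = b₃ = e`) or if `p₂ e` (take `b₂ = e`).
    have hP₂ : ∀ e, q (0, s e) ∈ P := by
      intro e
      by_cases h₁ : p₁ e
      · have := hq (Finsupp.single ⟨e, h₁⟩ 1) 0 (s e)
        rw [hs₁, map_zero, sub_self, zero_sub] at this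
        have e0 : q (0, s e) = - q (0, - s e) := by rw [← map_neg]; simp
        rw [e0, this, neg_zero]
        exact P.zero_mem
      · by_cases h₂ : p₂ e
        · have := hq 0 (Finsupp.single ⟨e, h₂⟩ 1) 0
          rw [hs₂, map_zero, sub_zero, sub_zero] at this
          rw [this]
          exact P.zero_mem
        · exact Submodule.subset_span ⟨e, ⟨h₁, h₂⟩, rfl⟩
    -- Taking `b₃ = -e` puts `(e, e)` in the range, so the class of `(e, 0)` is minus that of `(0,
    -- e)`.
    have hP₁ : ∀ e, q (s e, 0) ∈ P := by
      intro e
      have := hq 0 0 (- s e)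
      rw [map_zero, map_zero, zero_sub, neg_neg] at this
      have e0 : q (s e, 0) = q (s e, s e) - q (0, s e) := by rw [← map_sub]; simp
      rw [e0, this, zero_sub]
      exact P.neg_mem (hP₂ e)
    have hsmul : ∀ (e : E) (r : k), Finsupp.single e r = r • s e := by simp [s]
    have htop : P = ⊤ := by
      rw [eq_top_iff]
      rintro z -
      obtain ⟨⟨a, b⟩, rfl⟩ := Submodule.mkQ_surjective _ z
      have ha : q (a, 0) ∈ P := by
        induction a using Finsupp.induction_linear with
        | zero => exact (map_zero q).symm ▸ P.zero_mem
        | add x y hx hy =>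
          have : q (x + y, 0) = q (x, 0) + q (y, 0) := by rw [← map_add]; simp
          exact this ▸ P.add_mem hx hy
        | single e r =>
          have : q (Finsupp.single e r, 0) = r • q (s e, 0) := by
            rw [← map_smul, hsmul]; simp
          exact this ▸ P.smul_mem r (hP₁ e)
      have hb : q (0, b) ∈ P := by
        induction b using Finsupp.induction_linear with
        | zero => exact (map_zero q).symm ▸ P.zero_mem
        | add x y hx hy =>
          have : q (0, x + y) = q (0, x) + q (0, y) := by rw [← map_add]; simp
          exact this ▸ P.add_mem hx hy
        | single e r =>
          have : q (0, Finsupp.single e r) = r • q (0, s e) := by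
            rw [← map_smul, hsmul]; simp
          exact this ▸ P.smul_mem r (hP₂ e)
      have : q (a, b) = q (a, 0) + q (0, b) := by rw [← map_add]; simp
      exact this ▸ P.add_mem ha hb
    exact ⟨htop ▸ Submodule.fg_span (h'.image _)⟩

end KDiagram

/-! ### Decomposition into perfect matchings -/

/-- A form of **Hall's theorem**: in a regular bipartite multigraph with finite degrees, one side
can be matched into the other. -/
theorem exists_injective_of_regular {α β : Type*} (A : α → β → ℕ) (N : α → Finset β)
    (N' : β → Finset α) {S : ℕ} (hS : 0 < S) (hN' : ∀ a b, A a b ≠ 0 → a ∈ N' b)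
    (row : ∀ a, ∑ b ∈ N a, A a b = S) (col : ∀ b, ∑ a ∈ N' b, A a b = S) :
    ∃ f : α → β, Function.Injective f ∧ ∀ a, A a (f a) ≠ 0 := by
  classical
  obtain ⟨f, hf, hf'⟩ := (Finset.all_card_le_biUnion_card_iff_exists_injective
    fun a => (N a).filter fun b => A a b ≠ 0).1 (fun X => by
      refine Nat.le_of_mul_le_mul_right ?_ hS
      set U := X.biUnion fun a => (N a).filter fun b => A a b ≠ 0 with hU
      -- Double counting for Hall's condition: `X.card * S` edges leave `X`, all of them end in `U`,
      -- and `U` receives only `U.card * S` edges.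
      calc X.card * S = ∑ a ∈ X, ∑ b ∈ N a, A a b := by simp [row]
        _ ≤ ∑ a ∈ X, ∑ b ∈ U, A a b := Finset.sum_le_sum fun a ha => by
            rw [← Finset.sum_filter_ne_zero]
            exact Finset.sum_le_sum_of_subset (Finset.subset_biUnion_of_mem
              (fun a => (N a).filter fun b => A a b ≠ 0) ha)
        _ = ∑ b ∈ U, ∑ a ∈ X, A a b := Finset.sum_comm
        _ ≤ ∑ b ∈ U, ∑ a ∈ N' b, A a b := Finset.sum_le_sum fun b _ =>
            Finset.sum_le_sum_of_ne_zero fun a _ h => hN' a b h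
        _ = U.card * S := by simp [col])
  exact ⟨f, hf, fun a => (Finset.mem_filter.1 (hf' a)).2⟩

/-- A regular bipartite multigraph on `ℤ ⊔ ℤ`, whose edges lie in a band, is a sum of perfect
matchings. -/
theorem exists_perfectMatchings (lo hi : ℤ) (S : ℕ) : ∀ (A : ℤ → ℤ → ℕ),
    (∀ x y, A x y ≠ 0 → lo < x + y ∧ x + y ≤ hi) →
    (∀ x, ∑ y ∈ Finset.Ioc (lo - x) (hi - x), A x y = S) →
    (∀ y, ∑ x ∈ Finset.Ioc (lo - y) (hi - y), A x y = S) →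
    ∃ M : Fin S → ℤ × ℤ → ℤ, (∀ r, IsPerfectMatching (M r)) ∧
      ∀ x y, (A x y : ℤ) = ∑ r, M r (x, y) := by
  induction S with
  | zero =>
    intro A hA row _
    refine ⟨Fin.elim0, fun r => r.elim0, fun x y => ?_⟩
    by_contra h
    have h0 : A x y ≠ 0 := by simpa using h
    have := hA x y h0
    exact h0 (Finset.sum_eq_zero_iff.1 (row x) y (by rw [Finset.mem_Ioc]; omega))
  | succ S ih =>
    intro A hA row col
    have mem : ∀ x y, A x y ≠ 0 → y ∈ Finset.Ioc (lo - x) (hi - x) := fun x y h => by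
      have := hA x y h
      rw [Finset.mem_Ioc]; omega
    have mem' : ∀ x y, A x y ≠ 0 → x ∈ Finset.Ioc (lo - y) (hi - y) := fun x y h => by
      have := hA x y h
      rw [Finset.mem_Ioc]; omega
    obtain ⟨f, hf, hAf⟩ := exists_injective_of_regular A _ _ S.succ_pos mem' row col
    obtain ⟨g, hg, hAg⟩ := exists_injective_of_regular (fun y x => A x y) _ _ S.succ_pos
      (fun y x => mem x y) col row
    -- Hall's theorem gives an injection from each side. The Schröder–Bernstein bijection uses only
    -- pairs matched by `f` or by `g`, so it consists of edges of `A`.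
    obtain ⟨h, hbij, hh⟩ := Function.Embedding.schroeder_bernstein_of_rel hf hg
      (fun x y => A x y ≠ 0) hAf hAg
    let π : Equiv.Perm ℤ := Equiv.ofBijective h hbij
    have hπ : ∀ x, A x (π x) ≠ 0 := hh
    let P : ℤ → ℤ → ℕ := fun x y => if y = π x then 1 else 0
    have hP : ∀ x y, P x y ≤ A x y := by
      intro x y
      by_cases e : y = π x
      · subst e
        simpa [P, Nat.one_le_iff_ne_zero] using hπ x
      · simp [P, e]
    obtain ⟨M, hM, hsum⟩ := ih (fun x y => A x y - P x y)
      (fun x y h => hA x y fun h0 => h (by simp [h0]))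
      (fun x => by
        rw [Finset.sum_tsub_distrib _ fun y _ => hP x y, row]
        simp only [P, Finset.sum_ite_eq', if_pos (mem _ _ (hπ x))]
        rfl)
      (fun y => by
        rw [Finset.sum_tsub_distrib _ fun x _ => hP x y, col]
        have e : ∀ x, P x y = if x = π.symm y then 1 else 0 := fun x => by
          simp only [P, Equiv.eq_symm_apply, eq_comm]
        have hy := mem' (π.symm y) y (by simpa using hπ (π.symm y))
        simp only [e, Finset.sum_ite_eq', if_pos hy]
        rfl)
    -- The matching inherits the band of `A`; this is what makes it initially and eventually zero.
    have hband : ∀ p : ℤ × ℤ, (P p.1 p.2 : ℤ) ≠ 0 → lo < p.1 + p.2 ∧ p.1 + p.2 ≤ hi := by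
      intro p h
      refine hA _ _ fun h0 => h ?_
      have := hP p.1 p.2
      rw [h0] at this
      simpa using this
    refine ⟨Fin.cons (fun p => (P p.1 p.2 : ℤ)) M, ?_, fun x y => ?_⟩
    · refine Fin.cases ?_ (fun r => by simpa using hM r)
      rw [Fin.cons_zero]
      refine ⟨⟨lo, fun p hp => ?_⟩, ⟨hi + 1, fun p hp => ?_⟩, π, fun i j => ?_⟩
      · by_contra h
        have := hband p h
        omega
      · by_contra h
        have := hband p h
        omega
      · simp [P]
    · rw [Fin.sum_univ_succ]
      simp only [Fin.cons_zero, Fin.cons_succ]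
      rw [← hsum, Nat.cast_sub (hP x y)]
      ring

/-- A bounded integer matrix in a band, all of whose row and column sums are one, is a virtual sum
of perfect matchings. -/
theorem nonempty_matchingDecomposition {W : ℤ × ℤ → ℤ} {lo hi : ℤ}
    (hW : ∀ x y, W (x, y) ≠ 0 → lo < x + y ∧ x + y ≤ hi)
    (row : ∀ x, ∑ y ∈ Finset.Ioc (lo - x) (hi - x), W (x, y) = 1)
    (col : ∀ y, ∑ x ∈ Finset.Ioc (lo - y) (hi - y), W (x, y) = 1)
    (hb : IsBoundedWeight W) : Nonempty (MatchingDecomposition W) := by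
  obtain ⟨C, hC⟩ := hb
  have hC0 : 0 ≤ C := (abs_nonneg _).trans (hC (0, 0))
  lift C to ℕ using hC0
  let B : ℤ → ℤ → ℕ := fun x y => if lo < x + y ∧ x + y ≤ hi then C else 0
  let A : ℤ → ℤ → ℕ := fun x y => (W (x, y) + B x y).toNat
  have hA : ∀ x y, (A x y : ℤ) = W (x, y) + B x y := by
    intro x y
    refine Int.toNat_of_nonneg ?_
    by_cases h : lo < x + y ∧ x + y ≤ hi
    · have := (abs_le.1 (hC (x, y))).1
      simp only [B, if_pos h]
      omega
    · have : W (x, y) = 0 := by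
        by_contra h0
        exact h (hW x y h0)
      simp [B, if_neg h, this]
  -- Each row and each column meets the band in `hi - lo` cells, so `B` is `m`-regular and `A` is
  -- `(m + 1)`-regular.
  let m : ℕ := (hi - lo).toNat * C
  have rowB : ∀ x, ∑ y ∈ Finset.Ioc (lo - x) (hi - x), B x y = m := by
    intro x
    rw [Finset.sum_congr rfl (g := fun _ => C) fun y hy => by
      rw [Finset.mem_Ioc] at hy
      exact if_pos ⟨by omega, by omega⟩]
    simp [m]
  have colB : ∀ y, ∑ x ∈ Finset.Ioc (lo - y) (hi - y), B x y = m := by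
    intro y
    rw [Finset.sum_congr rfl (g := fun _ => C) fun x hx => by
      rw [Finset.mem_Ioc] at hx
      exact if_pos ⟨by omega, by omega⟩]
    simp [m]
  have bandB : ∀ x y, B x y ≠ 0 → lo < x + y ∧ x + y ≤ hi := by
    intro x y h
    by_contra h0
    exact h (if_neg h0)
  obtain ⟨neg, hneg, hnegsum⟩ := exists_perfectMatchings lo hi m B bandB rowB colB
  obtain ⟨pos, hpos, hpossum⟩ := exists_perfectMatchings lo hi (m + 1) A
    (fun x y h => by
      by_contra h0
      refine h ?_
      have h1 : W (x, y) = 0 := by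
        by_contra h2
        exact h0 (hW x y h2)
      simp [A, B, if_neg h0, h1])
    (fun x => by
      zify
      simp only [hA, Finset.sum_add_distrib, row]
      rw [← Nat.cast_sum, rowB, add_comm])
    (fun y => by
      zify
      simp only [hA, Finset.sum_add_distrib, col]
      rw [← Nat.cast_sum, colB, add_comm])
  exact ⟨⟨m, pos, neg, hpos, hneg, fun ⟨x, y⟩ => by
    rw [← hpossum, ← hnegsum, hA]
    ring⟩⟩

theorem IsPerfectMatching.abs_le_one {W : ℤ × ℤ → ℤ} (hW : IsPerfectMatching W) (p : ℤ × ℤ) :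
    |W p| ≤ 1 := by
  obtain ⟨-, -, π, hπ⟩ := hW
  obtain ⟨x, y⟩ := p
  rw [hπ]
  split_ifs <;> simp

theorem MatchingDecomposition.isBoundedWeight {W : ℤ × ℤ → ℤ} (D : MatchingDecomposition W) :
    IsBoundedWeight W := by
  refine ⟨(D.m + 1 : ℕ) + D.m, fun p => ?_⟩
  rw [D.sum_eq]
  refine (abs_sub _ _).trans (add_le_add ?_ ?_)
  · refine (Finset.abs_sum_le_sum_abs _ _).trans ?_
    refine (Finset.sum_le_sum fun r _ => (D.pos_matching r).abs_le_one p).trans ?_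
    simp
  · refine (Finset.abs_sum_le_sum_abs _ _).trans ?_
    refine (Finset.sum_le_sum fun r _ => (D.neg_matching r).abs_le_one p).trans ?_
    simp

/-! ### Weights of Riemann functions -/

theorem sum_Ioc_sub_sub_one (h : ℤ → ℤ) {a b : ℤ} (hab : a ≤ b) :
    ∑ x ∈ Finset.Ioc a b, (h x - h (x - 1)) = h b - h a := by
  induction b, hab using Int.leInduction with
  | base => simp
  | succ b hab ih =>
    rw [← Finset.insert_Ioc_right_eq_Ioc_add_one hab, Finset.sum_insert (by simp), ih]
    simp

theorem sum_Ioc_weight_right (g : ℤ × ℤ → ℤ) (x : ℤ) {a b : ℤ} (hab : a ≤ b) :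
    ∑ y ∈ Finset.Ioc a b, weight g (x, y) =
      (g (x, b) - g (x - 1, b)) - (g (x, a) - g (x - 1, a)) := by
  rw [← sum_Ioc_sub_sub_one (fun y => g (x, y) - g (x - 1, y)) hab]
  refine Finset.sum_congr rfl fun y _ => ?_
  simp only [weight]
  ring

theorem sum_Ioc_weight_left (g : ℤ × ℤ → ℤ) (y : ℤ) {a b : ℤ} (hab : a ≤ b) :
    ∑ x ∈ Finset.Ioc a b, weight g (x, y) =
      (g (b, y) - g (b, y - 1)) - (g (a, y) - g (a, y - 1)) := by
  rw [← sum_Ioc_sub_sub_one (fun x => g (x, y) - g (x, y - 1)) hab]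
  refine Finset.sum_congr rfl fun x _ => ?_
  simp only [weight]
  ring

/-- The sum of the values in the square `(a, b]²`. -/
noncomputable def boxSum (W : ℤ × ℤ → ℤ) (a b : ℤ) : ℤ :=
  ∑ x ∈ Finset.Ioc a b, ∑ y ∈ Finset.Ioc a b, W (x, y)

theorem boxSum_weight (g : ℤ × ℤ → ℤ) {a b : ℤ} (hab : a ≤ b) :
    boxSum (weight g) a b = g (b, b) - g (a, b) - g (b, a) + g (a, a) := by
  simp only [boxSum, sum_Ioc_weight_right g _ hab, Finset.sum_sub_distrib]
  rw [← Finset.sum_sub_distrib, ← Finset.sum_sub_distrib,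
    sum_Ioc_sub_sub_one (fun x => g (x, b)) hab, sum_Ioc_sub_sub_one (fun x => g (x, a)) hab]
  ring

theorem vecDeg_add_single_add_single {n : ℕ} (d : Fin n → ℤ) (i j : Fin n) (x y : ℤ) :
    vecDeg (d + Pi.single i x + Pi.single j y) = vecDeg d + x + y := by
  simp [vecDeg, Finset.sum_add_distrib]

section Riemann

variable {n : ℕ} {f : (Fin n → ℤ) → ℤ} {C a b : ℤ}

theorem twoVar_eq_zero (ha : ∀ d, vecDeg d ≤ a → f d = 0) (i j : Fin n) (d : Fin n → ℤ)
    {x y : ℤ} (h : x + y ≤ a - vecDeg d) : twoVar f i j d (x, y) = 0 := by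
  apply ha
  rw [vecDeg_add_single_add_single]
  linarith

theorem twoVar_eq_add (hb : ∀ d, b ≤ vecDeg d → f d = vecDeg d + C) (i j : Fin n)
    (d : Fin n → ℤ) {x y : ℤ} (h : b - vecDeg d ≤ x + y) :
    twoVar f i j d (x, y) = vecDeg d + x + y + C := by
  rw [← vecDeg_add_single_add_single d i j x y]
  apply hb
  rw [vecDeg_add_single_add_single]
  linarith

/-- The weight vanishes where `g` is zero or affine. A row sum telescopes to the increment of `g` in
`x` above the band, which is `1`, minus that below, which is `0`; columns are symmetric. -/
theorem IsRiemann.nonempty_matchingDecomposition (hf : IsRiemann f) (i j : Fin n)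
    (d : Fin n → ℤ) (h : IsBoundedWeight (restrictionWeight f i j d)) :
    Nonempty (MatchingDecomposition (restrictionWeight f i j d)) := by
  obtain ⟨C, a, b, ha, hb⟩ := hf
  set g := twoVar f i j d
  obtain ⟨lo, hlo⟩ : ∃ lo : ℤ, lo ≤ a - vecDeg d := ⟨_, le_rfl⟩
  -- The `+ 1` is needed because the weight in degree `hi + 1` involves values of `g` down to degree
  -- `hi - 1`.
  obtain ⟨hi, hhi, hlohi⟩ : ∃ hi : ℤ, b - vecDeg d + 1 ≤ hi ∧ lo ≤ hi :=
    ⟨max (b - vecDeg d + 1) lo, le_max_left _ _, le_max_right _ _⟩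
  have g0 : ∀ {x y : ℤ}, x + y ≤ lo → g (x, y) = 0 := fun h =>
    twoVar_eq_zero ha i j d (h.trans hlo)
  have g1 : ∀ {x y : ℤ}, hi - 1 ≤ x + y → g (x, y) = vecDeg d + x + y + C := fun h =>
    twoVar_eq_add hb i j d (by linarith)
  refine _root_.nonempty_matchingDecomposition (lo := lo) (hi := hi) ?_ ?_ ?_ h
  · intro x y hxy
    by_contra hcon
    apply hxy
    change weight g (x, y) = 0
    simp only [weight]
    by_cases hlt : lo < x + y
    · rw [g1, g1, g1, g1]
      · ring
      all_goals omega
    · rw [g0, g0, g0, g0]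
      · ring
      all_goals omega
  · intro x
    change ∑ y ∈ _, weight g (x, y) = 1
    rw [sum_Ioc_weight_right g x (by omega), g1, g1, g0, g0]
    · ring
    all_goals omega
  · intro y
    change ∑ x ∈ _, weight g (x, y) = 1
    rw [sum_Ioc_weight_left g y (by omega), g1, g1, g0, g0]
    · ring
    all_goals omega

open Filter in
-- A box sum is an alternating sum of `g` over the four corners. Apart from the corner `(0, 0)`,
-- where `g` is `f d`, all corners lie in the zero range, respectively the affine range, once `N` is
-- large.
theorem eventually_boxSum_restrictionWeight (ha : ∀ d, vecDeg d ≤ a → f d = 0)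
    (hb : ∀ d, b ≤ vecDeg d → f d = vecDeg d + C) (i j : Fin n) (d : Fin n → ℤ) :
    ∀ᶠ N : ℤ in atTop, boxSum (restrictionWeight f i j d) (-N) 0 = f d ∧
      boxSum (restrictionWeight f i j d) 0 N = f d - vecDeg d - C := by
  have h00 : twoVar f i j d (0, 0) = f d := by simp [twoVar]
  filter_upwards [eventually_ge_atTop 0, eventually_ge_atTop (vecDeg d - a),
    eventually_ge_atTop (b - vecDeg d)] with N h₀ h₁ h₂
  simp only [restrictionWeight]
  constructor
  · rw [boxSum_weight _ (by omega), h00, twoVar_eq_zero ha, twoVar_eq_zero ha, twoVar_eq_zero ha]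
    · ring
    all_goals omega
  · rw [boxSum_weight _ h₀, h00, twoVar_eq_add hb, twoVar_eq_add hb, twoVar_eq_add hb]
    · ring
    all_goals omega

end Riemann

/-! ### Counting edges -/

namespace KDiagram

variable {k : Type u} [Field k]

/-- An edge diagram with infinitely many edges of both mixed types is determined up to isomorphism
by the numbers of edges of the two other types. -/
theorem nonempty_iso_edgeDiagram {E E' : Type} [Countable E] [Countable E'] {p₁ p₂ : E → Prop}
    {p₁' p₂' : E' → Prop}
    (h₁₂ : Infinite {e // p₁ e ∧ ¬ p₂ e}) (h₂₁ : Infinite {e // ¬ p₁ e ∧ p₂ e})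
    (h₁₂' : Infinite {e // p₁' e ∧ ¬ p₂' e}) (h₂₁' : Infinite {e // ¬ p₁' e ∧ p₂' e})
    (h : Nonempty ({e // p₁ e ∧ p₂ e} ≃ {e // p₁' e ∧ p₂' e}))
    (h₀ : Nonempty ({e // ¬ p₁ e ∧ ¬ p₂ e} ≃ {e // ¬ p₁' e ∧ ¬ p₂' e})) :
    Nonempty (Iso (edgeDiagram k p₁ p₂) (edgeDiagram k p₁' p₂')) := by
  let c : E → Prop × Prop := fun e => (p₁ e, p₂ e)
  let c' : E' → Prop × Prop := fun e => (p₁' e, p₂' e)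
  -- The edges of each type are matched separately: mixed types are countably infinite on both
  -- sides, and the other two are given by hypothesis. The bijections are then glued along the
  -- fibres of the type maps.
  have key : ∀ t : Prop × Prop, Nonempty ({e // c e = t} ≃ {e // c' e = t}) := by
    rintro ⟨s, t⟩
    by_cases hs : s <;> by_cases ht : t <;>
      simp only [c, c', Prod.mk.injEq, hs, ht, eq_iff_iff, iff_true, iff_false]
    · exact h
    · exact nonempty_equiv_of_countable
    · exact nonempty_equiv_of_countable
    · exact h₀
  have φ := fun t => (key t).some
  let ψ : E ≃ E' := (Equiv.sigmaFiberEquiv c).symm.trans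
    ((Equiv.sigmaCongrRight φ).trans (Equiv.sigmaFiberEquiv c'))
  have hψ : ∀ e, c' (ψ e) = c e := fun e => (φ (c e) ⟨e, rfl⟩).2
  exact ⟨edgeCongr ψ (fun e => (congrArg Prod.fst (hψ e)).symm.to_iff)
    fun e => (congrArg Prod.snd (hψ e)).symm.to_iff⟩

end KDiagram

section Counting

theorem nonempty_subtype_sum_equiv {E F E' F' : Type*} {p : E ⊕ F → Prop} {p' : E' ⊕ F' → Prop}
    (_ : Finite {e // p (Sum.inl e)}) (_ : Finite {e // p (Sum.inr e)})
    (_ : Finite {e // p' (Sum.inl e)}) (_ : Finite {e // p' (Sum.inr e)})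
    (h : (Nat.card {e // p (Sum.inl e)} + Nat.card {e // p (Sum.inr e)} : ℤ) =
      Nat.card {e // p' (Sum.inl e)} + Nat.card {e // p' (Sum.inr e)}) :
    Nonempty ({e // p e} ≃ {e // p' e}) := by
  refine ⟨Equiv.subtypeSum.trans (Equiv.trans ?_ Equiv.subtypeSum.symm)⟩
  refine Nonempty.some (Finite.card_eq.1 ?_)
  rw [Nat.card_sum, Nat.card_sum]
  exact_mod_cast h

theorem infinite_subtype_sum {E F : Type*} {p : E ⊕ F → Prop}
    (_ : Infinite {e // p (Sum.inl e)}) : Infinite {e // p e} :=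
  Infinite.of_injective (fun e : {e // p (Sum.inl e)} => (⟨Sum.inl e.1, e.2⟩ : {e // p e}))
    fun _ _ h => Subtype.ext (Sum.inl_injective (congrArg Subtype.val h))

variable {W : ℤ × ℤ → ℤ} {π : Equiv.Perm ℤ}

theorem boxSum_eq_card (hπ : ∀ i j : ℤ, W (i, j) = if j = π i then 1 else 0) (a b : ℤ) :
    boxSum W a b = ((Finset.Ioc a b).filter fun x => π x ∈ Finset.Ioc a b).card := by
  simp only [boxSum, hπ, Finset.sum_ite_eq', Finset.sum_boole]

open Filter in
/-- In a perfect matching, the edges both of whose ends are nonpositive (respectively positive)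
lie in a bounded square. -/
theorem IsPerfectMatching.eventually_edges (hW : IsPerfectMatching W)
    (hπ : ∀ i j : ℤ, W (i, j) = if j = π i then 1 else 0) :
    ∀ᶠ N : ℤ in atTop,
      (∀ x, x ≤ 0 ∧ π x ≤ 0 ↔
        x ∈ (Finset.Ioc (-N) 0).filter fun x => π x ∈ Finset.Ioc (-N) 0) ∧
      (∀ x, ¬ x ≤ 0 ∧ ¬ π x ≤ 0 ↔
        x ∈ (Finset.Ioc 0 N).filter fun x => π x ∈ Finset.Ioc 0 N) := by
  obtain ⟨⟨a, ha⟩, ⟨b, hb⟩, -⟩ := hW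
  have h1 : ∀ x, W (x, π x) = 1 := fun x => by simp [hπ]
  filter_upwards [eventually_ge_atTop (-a), eventually_ge_atTop b] with N hN hN'
  -- If both ends are `≤ 0`, each of them exceeds their sum's lower bound `a ≥ -N`; dually, positive
  -- ends stay below `b ≤ N`.
  have hlo : ∀ x, a < x + π x := by
    intro x
    by_contra h
    have := ha (x, π x) (by simpa using h)
    rw [h1] at this
    omega
  have hhi : ∀ x, x + π x < b := by
    intro x
    by_contra h
    have := hb (x, π x) (by simpa using h)
    rw [h1] at this
    omega
  constructor
  · intro x
    have := hlo x
    simp only [Finset.mem_filter, Finset.mem_Ioc]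
    omega
  · intro x
    have := hhi x
    simp only [Finset.mem_filter, Finset.mem_Ioc]
    omega

variable {L : Type} {M : L → ℤ × ℤ → ℤ} {σ : L → Equiv.Perm ℤ}

open Filter in
-- The count is asserted for all large `N`, not for one, so that several families can later be
-- compared at a common `N`.
theorem eventually_card_edges [Fintype L] (hM : ∀ l, IsPerfectMatching (M l))
    (hσ : ∀ l, ∀ i j : ℤ, M l (i, j) = if j = σ l i then 1 else 0) :
    Finite {e : Σ _ : L, ℤ // e.2 ≤ 0 ∧ σ e.1 e.2 ≤ 0} ∧
    Finite {e : Σ _ : L, ℤ // ¬ e.2 ≤ 0 ∧ ¬ σ e.1 e.2 ≤ 0} ∧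
    ∀ᶠ N : ℤ in atTop,
      (Nat.card {e : Σ _ : L, ℤ // e.2 ≤ 0 ∧ σ e.1 e.2 ≤ 0} : ℤ) =
        ∑ l, boxSum (M l) (-N) 0 ∧
      (Nat.card {e : Σ _ : L, ℤ // ¬ e.2 ≤ 0 ∧ ¬ σ e.1 e.2 ≤ 0} : ℤ) =
        ∑ l, boxSum (M l) 0 N := by
  have H : ∀ᶠ N : ℤ in atTop,
      (∀ e : Σ _ : L, ℤ, e.2 ≤ 0 ∧ σ e.1 e.2 ≤ 0 ↔ e ∈ Finset.univ.sigma fun l =>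
        (Finset.Ioc (-N) 0).filter fun x => σ l x ∈ Finset.Ioc (-N) 0) ∧
      (∀ e : Σ _ : L, ℤ, ¬ e.2 ≤ 0 ∧ ¬ σ e.1 e.2 ≤ 0 ↔ e ∈ Finset.univ.sigma fun l =>
        (Finset.Ioc 0 N).filter fun x => σ l x ∈ Finset.Ioc 0 N) := by
    filter_upwards [eventually_all.2 fun l => (hM l).eventually_edges (hσ l)] with N hN
    exact ⟨fun e => by simpa using (hN e.1).1 e.2, fun e => by simpa using (hN e.1).2 e.2⟩
  obtain ⟨N, hN⟩ := H.exists
  refine ⟨(Finset.finite_toSet _).subset fun e he => (hN.1 e).1 he,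
    (Finset.finite_toSet _).subset fun e he => (hN.2 e).1 he, ?_⟩
  filter_upwards [H] with N hN
  constructor
  · rw [Nat.card_congr (Equiv.subtypeEquivRight hN.1), Nat.card_eq_fintype_card,
      Fintype.card_coe, Finset.card_sigma, Nat.cast_sum]
    exact Finset.sum_congr rfl fun l _ => (boxSum_eq_card (hσ l) _ _).symm
  · rw [Nat.card_congr (Equiv.subtypeEquivRight hN.2), Nat.card_eq_fintype_card,
      Fintype.card_coe, Finset.card_sigma, Nat.cast_sum]
    exact Finset.sum_congr rfl fun l _ => (boxSum_eq_card (hσ l) _ _).symm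

/-- In a single matching infinitely many edges start at `x ≤ 0` and infinitely many end at `π x ≤
0`, but only finitely many do both. -/
theorem infinite_mixed_edges [Nonempty L] (hM : ∀ l, IsPerfectMatching (M l))
    (hσ : ∀ l, ∀ i j : ℤ, M l (i, j) = if j = σ l i then 1 else 0) :
    Infinite {e : Σ _ : L, ℤ // e.2 ≤ 0 ∧ ¬ σ e.1 e.2 ≤ 0} ∧
    Infinite {e : Σ _ : L, ℤ // ¬ e.2 ≤ 0 ∧ σ e.1 e.2 ≤ 0} := by
  obtain ⟨l⟩ := ‹Nonempty L›
  obtain ⟨N, hN, -⟩ := ((hM l).eventually_edges (hσ l)).exists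
  have hfin : {x | x ≤ 0 ∧ σ l x ≤ 0}.Finite :=
    (Finset.finite_toSet _).subset fun x hx => (hN x).1 hx
  have h₁ : {x | x ≤ 0 ∧ ¬ σ l x ≤ 0}.Infinite :=
    ((Set.Iic_infinite (0 : ℤ)).sdiff hfin).mono fun x hx => ⟨hx.1, fun h => hx.2 ⟨hx.1, h⟩⟩
  have h₂ : {x | ¬ x ≤ 0 ∧ σ l x ≤ 0}.Infinite := by
    have : (σ l ⁻¹' Set.Iic 0).Infinite :=
      (Set.Iic_infinite (0 : ℤ)).preimage fun x _ => (σ l).surjective x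
    exact (this.sdiff hfin).mono fun x hx => ⟨fun h => hx.2 ⟨h, hx.1⟩, hx.1⟩
  have := h₁.to_subtype
  have := h₂.to_subtype
  constructor
  · exact Infinite.of_injective
      (fun x : {x | x ≤ 0 ∧ ¬ σ l x ≤ 0} => ⟨⟨l, x.1⟩, x.2⟩)
      fun x y h => by simpa [Subtype.ext_iff] using h
  · exact Infinite.of_injective
      (fun x : {x | ¬ x ≤ 0 ∧ σ l x ≤ 0} => ⟨⟨l, x.1⟩, x.2⟩)
      fun x y h => by simpa [Subtype.ext_iff] using h

end Counting

/-! ### Equivalence of the virtual diagrams -/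

section Virtual

variable {k : Type u} [Field k]

theorem isFredholm_directSum_modelDiagram {L : Type} [Fintype L] {M : L → ℤ × ℤ → ℤ}
    (hM : ∀ l, IsPerfectMatching (M l)) :
    (KDiagram.directSum fun l => modelDiagram k (M l) (0, 0)).IsFredholm := by
  choose σ hσ using fun l => (hM l).2.2
  obtain ⟨h, h', -⟩ := eventually_card_edges hM hσ
  exact (KDiagram.directSumModelIso hσ (0, 0)).symm.isFredholm
    (KDiagram.isFredholm_edgeDiagram h h')

open Filter in
/-- Sums of models of perfect matchings are isomorphic if they have the same numbers of edges with
both ends nonpositive and with both ends positive. -/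
theorem cls_directSum_modelDiagram_add {L K L' K' : Type} [Fintype L] [Fintype K] [Fintype L']
    [Fintype K'] [Nonempty L] [Nonempty L'] {M : L → ℤ × ℤ → ℤ} {P : K → ℤ × ℤ → ℤ}
    {M' : L' → ℤ × ℤ → ℤ} {P' : K' → ℤ × ℤ → ℤ}
    (hM : ∀ l, IsPerfectMatching (M l)) (hP : ∀ l, IsPerfectMatching (P l))
    (hM' : ∀ l, IsPerfectMatching (M' l)) (hP' : ∀ l, IsPerfectMatching (P' l))
    (h : ∀ᶠ N : ℤ in atTop,
      ∑ l, boxSum (M l) (-N) 0 + ∑ l, boxSum (P l) (-N) 0 =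
          ∑ l, boxSum (M' l) (-N) 0 + ∑ l, boxSum (P' l) (-N) 0 ∧
        ∑ l, boxSum (M l) 0 N + ∑ l, boxSum (P l) 0 N =
          ∑ l, boxSum (M' l) 0 N + ∑ l, boxSum (P' l) 0 N) :
    (KDiagram.directSum fun l => modelDiagram k (M l) (0, 0)).cls +
        (KDiagram.directSum fun l => modelDiagram k (P l) (0, 0)).cls =
      (KDiagram.directSum fun l => modelDiagram k (M' l) (0, 0)).cls +
        (KDiagram.directSum fun l => modelDiagram k (P' l) (0, 0)).cls := by
  choose σ hσ using fun l => (hM l).2.2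
  choose τ hτ using fun l => (hP l).2.2
  choose σ' hσ' using fun l => (hM' l).2.2
  choose τ' hτ' using fun l => (hP' l).2.2
  obtain ⟨fM, gM, cM⟩ := eventually_card_edges hM hσ
  obtain ⟨fP, gP, cP⟩ := eventually_card_edges hP hτ
  obtain ⟨fM', gM', cM'⟩ := eventually_card_edges hM' hσ'
  obtain ⟨fP', gP', cP'⟩ := eventually_card_edges hP' hτ'
  obtain ⟨iM, jM⟩ := infinite_mixed_edges hM hσ
  obtain ⟨iM', jM'⟩ := infinite_mixed_edges hM' hσ'
  obtain ⟨N, e, eM, eP, eM', eP'⟩ := (h.and (cM.and (cP.and (cM'.and cP')))).exists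
  rw [KDiagram.cls_eq_cls.2 ⟨KDiagram.directSumModelIso hσ (0, 0)⟩,
    KDiagram.cls_eq_cls.2 ⟨KDiagram.directSumModelIso hτ (0, 0)⟩,
    KDiagram.cls_eq_cls.2 ⟨KDiagram.directSumModelIso hσ' (0, 0)⟩,
    KDiagram.cls_eq_cls.2 ⟨KDiagram.directSumModelIso hτ' (0, 0)⟩,
    ← KDiagram.cls_sum, ← KDiagram.cls_sum,
    ← KDiagram.cls_eq_cls.2 ⟨KDiagram.edgeSum _ _ _ _⟩,
    ← KDiagram.cls_eq_cls.2 ⟨KDiagram.edgeSum _ _ _ _⟩, KDiagram.cls_eq_cls]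
  -- The nonempty families `M` and `M'` already supply infinitely many mixed edges, so `P` and `P'`
  -- may be empty.
  refine KDiagram.nonempty_iso_edgeDiagram (infinite_subtype_sum iM)
    (infinite_subtype_sum jM) (infinite_subtype_sum iM') (infinite_subtype_sum jM') ?_ ?_
  · refine nonempty_subtype_sum_equiv fM fP fM' fP' ?_
    exact (congrArg₂ (· + ·) eM.1 eP.1).trans (e.1.trans (congrArg₂ (· + ·) eM'.1 eP'.1).symm)
  · refine nonempty_subtype_sum_equiv gM gP gM' gP' ?_
    exact (congrArg₂ (· + ·) eM.2 eP.2).trans (e.2.trans (congrArg₂ (· + ·) eM'.2 eP'.2).symm)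

namespace MatchingDecomposition

variable {W W' : ℤ × ℤ → ℤ}

theorem boxSum_eq (D : MatchingDecomposition W) (a b : ℤ) :
    boxSum W a b = ∑ r, boxSum (D.pos r) a b - ∑ r, boxSum (D.neg r) a b := by
  have key : ∀ {L : Type} [Fintype L] (M : L → ℤ × ℤ → ℤ),
      ∑ x ∈ Finset.Ioc a b, ∑ y ∈ Finset.Ioc a b, ∑ l, M l (x, y) = ∑ l, boxSum (M l) a b :=
    fun M => (Finset.sum_congr rfl fun _ _ => Finset.sum_comm).trans Finset.sum_comm
  rw [← key, ← key]
  simp only [boxSum, D.sum_eq, Finset.sum_sub_distrib]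

theorem isFredholm_virtual (D : MatchingDecomposition W) :
    (D.virtual k (0, 0)).IsFredholm :=
  ⟨isFredholm_directSum_modelDiagram D.pos_matching,
    isFredholm_directSum_modelDiagram D.neg_matching⟩

open Filter in
/-- The class of `W` only depends on the sums of `W` over the quadrants of vectors with
nonpositive, respectively positive, coordinates. -/
theorem equivalent_virtual (D : MatchingDecomposition W) (D' : MatchingDecomposition W')
    (h : ∀ᶠ N : ℤ in atTop, boxSum W (-N) 0 = boxSum W' (-N) 0 ∧
      boxSum W 0 N = boxSum W' 0 N) :
    (D.virtual k (0, 0)).Equivalent (D'.virtual k (0, 0)) := by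
  -- The two sums are isomorphic before stabilization, so any Fredholm diagram can serve as `F₀`.
  refine VirtualDiagram.equivalent_iff.2 ⟨D.isFredholm_virtual, D'.isFredholm_virtual,
    (D.virtual k (0, 0)).plus, D.isFredholm_virtual.1, congrArg (· + _) ?_⟩
  -- The families in the roles of `M` and `M'` are the positive parts, which are nonempty because `s
  -- = m + 1 ≥ 1`.
  refine cls_directSum_modelDiagram_add D.pos_matching D'.neg_matching D'.pos_matching
    D.neg_matching ?_
  filter_upwards [h] with N hN
  rw [D.boxSum_eq, D'.boxSum_eq, D.boxSum_eq, D'.boxSum_eq] at hN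
  omega

theorem virtualClass_eq (D : MatchingDecomposition W) :
    virtualClass k W (0, 0) = {V | V.Equivalent (D.virtual k (0, 0))} :=
  Set.ext fun _ => ⟨fun ⟨D', hV⟩ => hV.trans (D'.equivalent_virtual D (by simp)),
    fun hV => ⟨D, hV⟩⟩

end MatchingDecomposition

theorem IsRiemann.restrictionClass_eq {n : ℕ} {f : (Fin n → ℤ) → ℤ} (hf : IsRiemann f)
    (d : Fin n → ℤ) {i j i' j' : Fin n} (h : IsBoundedWeight (restrictionWeight f i j d))
    (h' : IsBoundedWeight (restrictionWeight f i' j' d)) :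
    restrictionClass k f i j d = restrictionClass k f i' j' d := by
  obtain ⟨D⟩ := hf.nonempty_matchingDecomposition i j d h
  obtain ⟨D'⟩ := hf.nonempty_matchingDecomposition i' j' d h'
  obtain ⟨C, a, b, ha, hb⟩ := hf
  rw [restrictionClass, restrictionClass, D.virtualClass_eq, D'.virtualClass_eq]
  refine VirtualDiagram.setOf_equivalent_eq (D.equivalent_virtual D' ?_)
  filter_upwards [eventually_boxSum_restrictionWeight ha hb i j d,
    eventually_boxSum_restrictionWeight ha hb i' j' d] with N hN hN'
  exact ⟨hN.1.trans hN'.1.symm, hN.2.trans hN'.2.symm⟩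

end Virtual

theorem mainTheorem5 (k : Type u) [Field k] {n : ℕ} (f : (Fin n → ℤ) → ℤ) (hf : IsRiemann f)
    (d : Fin n → ℤ) :
    -- the class is defined exactly for bounded weights, and is then a single equivalence class
    (∀ i j : Fin n, i ≠ j →
      (Nonempty (MatchingDecomposition (restrictionWeight f i j d)) ↔
        IsBoundedWeight (restrictionWeight f i j d)) ∧
      ∀ D : MatchingDecomposition (restrictionWeight f i j d),
        D.virtual k (0, 0) ∈ restrictionClass k f i j d ∧
        restrictionClass k f i j d = {V | V.Equivalent (D.virtual k (0, 0))}) ∧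
    -- three distinct indices (so that `n ≥ 3`)
    (∀ i j j' : Fin n, i ≠ j → i ≠ j' → j ≠ j' →
      IsBoundedWeight (restrictionWeight f i j d) →
      IsBoundedWeight (restrictionWeight f i j' d) →
      restrictionClass k f i j d = restrictionClass k f i j' d) ∧
    -- independence of the pair of distinct indices (so that `n ≥ 2`)
    (∀ i j i' j' : Fin n, i ≠ j → i' ≠ j' →
      IsBoundedWeight (restrictionWeight f i j d) →
      IsBoundedWeight (restrictionWeight f i' j' d) →
      restrictionClass k f i j d = restrictionClass k f i' j' d) := by
  refine ⟨fun i j _ => ⟨⟨fun ⟨D⟩ => D.isBoundedWeight,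
    hf.nonempty_matchingDecomposition i j d⟩, fun D => ⟨?_, D.virtualClass_eq⟩⟩,
    fun _ _ _ _ _ _ h h' => hf.restrictionClass_eq d h h',
    fun _ _ _ _ _ _ h h' => hf.restrictionClass_eq d h h'⟩
  exact ⟨D, D.equivalent_virtual D (by simp)⟩
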